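/- Let $n\ge 0$ be an integer, let $\Gamma$ be a set, and let $\Lambda\subseteq\Gamma$ be finite. Let $m_k>0$ and $\nu_k>0$ ($k\in\Gamma$) be masses and force constants, and for $k,l\in\Gamma$ let $V_{kl}\in C_{\mathrm c}^\infty(\mathbb R^n,\mathbb R)$ satisfy $V_{kl}(x)=V_{lk}(-x)$ for all $x\in\mathbb{R}^n$. Let $\Omega_\Lambda=\{(p,q): p,q\in(\mathbb R^n)^\Lambda\}\cong\mathbb R^{2n|\Lambda|}$ with its Euclidean inner product. Let $\mathcal N\subseteq\{\{k,l\}: k,l\in\Lambda,\ k\ne l\}$ be a set of unordered pairs, and put $$H_{\mathcal N}(p,q)=\sum_{l\in\Lambda}\Big(\frac{\|p_l\|^2}{2m_l}+\frac{\nu_l\|q_l\|^2}{2}\Big)+\sum_{\{k,l\}\in\mathcal N}V_{kl}(q_k-q_l).$$ For a real inner product space $X$, let $C_{\mathcal R}(X)$ be the commutative resolvent algebra on $X$, that is, the C*-subalgebra of $C_{\mathrm b}(X)$ (bounded continuous functions $X\to\mathbb C$) generated by the functions $y\mapsto 1/(i\lambda-x\cdot y)$ with $x\in X$ and $\lambda\in\mathbb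 R\setminus\{0\}$. Then the Hamilton equations $(\dot p,\dot q)=(-\nabla_qH_{\mathcal N},\nabla_pH_{\mathcal N})$ have a unique global flow $\Phi^t_{H_{\mathcal N}}:\Omega_\Lambda\to\Omega_\Lambda$ $(t\in\mathbb R)$, each $\Phi^t_{H_{\mathcal N}}$ is continuous, and for every $t\in\mathbb R$ the pull-back $(\Phi^t_{H_{\mathcal N}})^*f=f\circ\Phi^t_{H_{\mathcal N}}$ satisfies $$(\Phi^t_{H_{\mathcal N}})^*\big(C_{\mathcal R}(\Omega_\Lambda)\big)= C_{\mathcal R}(\Omega_\Lambda).$$ In particular $(\Phi^t_{H_{\mathcal N}})^*(C_{\mathcal R}(\Omega_\Lambda))\subseteq C_{\mathcal R}(\Omega_\Lambda)$ for every $t>0$. -/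

import Mathlib

open scoped ContDiff

noncomputable section

namespace CommResolvent

section Algebra

variable {X : Type*} [NormedAddCommGroup X] [InnerProductSpace ℝ X]

theorem resolvent_denom_ne_zero {c : ℝ} (hc : c ≠ 0) (s : ℝ) :
    Complex.I * (c : ℂ) - (s : ℂ) ≠ 0 := by
  intro h
  apply hc
  simpa using congrArg Complex.im h

theorem norm_resolvent_le {c : ℝ} (hc : c ≠ 0) (s : ℝ) :
    ‖1 / (Complex.I * (c : ℂ) - (s : ℂ))‖ ≤ 1 / |c| := by
  rw [norm_div, norm_one]
  apply one_div_le_one_div_of_le (abs_pos.mpr hc)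
  simpa using Complex.abs_im_le_norm (Complex.I * (c : ℂ) - (s : ℂ))

/-- The classical resolvent `y ↦ 1 / (i c - x · y)` with `c ≠ 0`, as an element of `C_b(X)`. -/
def classicalResolvent (x : X) (c : ℝ) (hc : c ≠ 0) : BoundedContinuousFunction X ℂ :=
  BoundedContinuousFunction.ofNormedAddCommGroup
    (fun y => 1 / (Complex.I * (c : ℂ) - ((inner ℝ x y : ℝ) : ℂ)))
    (continuous_const.div
      (continuous_const.sub
        (Complex.continuous_ofReal.comp (continuous_const.inner continuous_id)))
      (fun y => resolvent_denom_ne_zero hc (inner ℝ x y)))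
    (1 / |c|)
    (fun y => norm_resolvent_le hc (inner ℝ x y))

variable (X) in
/-- The commutative resolvent algebra `C_R(X)`: the norm closed star-subalgebra of `C_b(X)`
generated by the classical resolvents. (The generator with `x = 0` is a nonzero constant, so the
unital and the non-unital generated algebras agree.) -/
def resolventAlgebra : StarSubalgebra ℂ (BoundedContinuousFunction X ℂ) :=
  (StarAlgebra.adjoin ℂ
    {f : BoundedContinuousFunction X ℂ |
      ∃ (x : X) (c : ℝ) (hc : c ≠ 0), f = classicalResolvent x c hc}).topologicalClosure

end Algebra

section Mechanics

variable {Γ : Type*}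

/-- `(ℝⁿ)^Λ` with its Euclidean inner product; coordinates are indexed by a particle and a
direction. -/
abbrev Config (Λ : Finset Γ) (n : ℕ) : Type _ :=
  EuclideanSpace ℝ (Λ × Fin n)

/-- The phase space `Ω_Λ ≅ ℝ^{2n|Λ|}` of pairs `(p, q)` with its Euclidean inner product; the left
summand indexes the coordinates of the momenta `p`, the right one those of the positions `q`. -/
abbrev PhaseSpace (Λ : Finset Γ) (n : ℕ) : Type _ :=
  EuclideanSpace ℝ ((Λ × Fin n) ⊕ (Λ × Fin n))

/-- The vector `q_l ∈ ℝⁿ` of the particle `l`. -/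
def particle {Λ : Finset Γ} {n : ℕ} (q : Config Λ n) (l : Λ) : EuclideanSpace ℝ (Fin n) :=
  WithLp.toLp 2 (fun i => q (l, i))

/-- `p` for `z = (p, q)`. -/
def mom {Λ : Finset Γ} {n : ℕ} (z : PhaseSpace Λ n) : Config Λ n :=
  WithLp.toLp 2 (fun a => z (Sum.inl a))

/-- `q` for `z = (p, q)`. -/
def pos {Λ : Finset Γ} {n : ℕ} (z : PhaseSpace Λ n) : Config Λ n :=
  WithLp.toLp 2 (fun a => z (Sum.inr a))

/-- The point `(p, q)`. -/
def mkPhase {Λ : Finset Γ} {n : ℕ} (p q : Config Λ n) : PhaseSpace Λ n :=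
  WithLp.toLp 2 (Sum.elim (fun a => p a) (fun a => q a))

/-- `H⁰_Λ(p, q) = ∑_l ‖p_l‖² / (2 m_l) + ν_l ‖q_l‖² / 2`. -/
def freeHamiltonian (Λ : Finset Γ) (n : ℕ) (m ν : Γ → ℝ) (z : PhaseSpace Λ n) : ℝ :=
  ∑ l : Λ, (‖particle (mom z) l‖ ^ 2 / (2 * m l) + ν l * ‖particle (pos z) l‖ ^ 2 / 2)

/-- The term `V_{kl}(q_k - q_l)` as a function of the unordered pair `{k, l}`; this makes sense
because `V_{kl}(x) = V_{lk}(-x)`. -/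
def pairTerm {Λ : Finset Γ} {n : ℕ} (V : Γ → Γ → EuclideanSpace ℝ (Fin n) → ℝ)
    (hV : ∀ k l x, V k l x = V l k (-x)) (q : Config Λ n) : Sym2 Λ → ℝ :=
  Sym2.lift ⟨fun k l => V k l (particle q k - particle q l), fun k l => by
    simpa only [neg_sub] using hV k l (particle q k - particle q l)⟩

/-- `H_N = H⁰_Λ + ∑_{{k,l} ∈ N} V_{kl}(q_k - q_l)`. -/
def hamiltonian (Λ : Finset Γ) (n : ℕ) (m ν : Γ → ℝ)
    (V : Γ → Γ → EuclideanSpace ℝ (Fin n) → ℝ) (hV : ∀ k l x, V k l x = V l k (-x))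
    (N : Finset (Sym2 Λ)) (z : PhaseSpace Λ n) : ℝ :=
  freeHamiltonian Λ n m ν z + ∑ e ∈ N, pairTerm V hV (pos z) e

/-- The Hamiltonian vector field `X_H = (-∇_q H, ∇_p H)`. -/
def hamiltonianVectorField {Λ : Finset Γ} {n : ℕ} (H : PhaseSpace Λ n → ℝ)
    (z : PhaseSpace Λ n) : PhaseSpace Λ n :=
  mkPhase (-gradient (fun q : Config Λ n => H (mkPhase (mom z) q)) (pos z))
    (gradient (fun p : Config Λ n => H (mkPhase p (pos z))) (mom z))

/-- `Φ` is the (global) flow of the Hamilton equations of `H`: for every initial point `z`,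
`t ↦ Φ t z` is a solution on all of `ℝ` that starts at `z`. -/
def IsHamiltonianFlow {Λ : Finset Γ} {n : ℕ} (H : PhaseSpace Λ n → ℝ)
    (Φ : ℝ → PhaseSpace Λ n → PhaseSpace Λ n) : Prop :=
  ∀ z : PhaseSpace Λ n, Φ 0 z = z ∧
    ∀ t : ℝ, HasDerivAt (fun s => Φ s z) (hamiltonianVectorField H (Φ t z)) t

end Mechanics

end CommResolvent

end

/-! Hamilton's equations have the form `z' = A z + Y z`, where `A` generates the uncoupled
oscillators and `Y` is a finite sum of terms `B e (g e (L e z))` with `g e` the gradient of a pair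
potential, hence bounded and Lipschitz. This yields a unique global flow. The flow is a uniform
limit of iterates of `exp (hA) ∘ (id + D_h)`, where `D_h z = ∫ s in 0..h, exp (-sA) (Y (exp (sA)
z))`, and the resolvent algebra is stable under such limits.

The average over `s` is essential: replacing `D_h` by `h • Y` spoils the uniformity in `z` of the
local error `O(h ^ 2)`, because `exp (sA) z - z` grows with `z`. The price is to show that the
components of `D_h` lie in the algebra (`isResolventFunction_timeAverage`). By analyticity in `s`, a
direction not annihilated by all `L e ∘ exp (sA)` is annihilated only for a null set of `s`, so by
dominated convergence the average vanishes at infinity modulo the common kernel. Such functions lie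
in the algebra by Stone–Weierstrass (`isResolventFunction_of_tendsto_zero`), and translation by them
preserves it (`PreservesResolventAlgebra.id_add`). Reversing time gives the remaining inclusion. -/

namespace CommResolvent

open Filter Topology Set
open scoped BoundedContinuousFunction NNReal

section Pullback

variable {X Y : Type*} [TopologicalSpace X] [TopologicalSpace Y]

/-- Composition with a continuous map, as a star-homomorphism between algebras of bounded
continuous functions. -/
noncomputable def pullback (ψ : C(X, Y)) : (Y →ᵇ ℂ) →⋆ₐ[ℂ] (X →ᵇ ℂ) where
  toFun f := f.compContinuous ψ
  map_one' := rfl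
  map_mul' _ _ := rfl
  map_zero' := rfl
  map_add' _ _ := rfl
  commutes' _ := rfl
  map_star' _ := rfl

/-- Composition of a continuous function on a compact space with a continuous map, as a
star-homomorphism. -/
noncomputable def pullbackOfCompact [CompactSpace Y] (ψ : C(X, Y)) :
    C(Y, ℂ) →⋆ₐ[ℂ] (X →ᵇ ℂ) where
  toFun f := (BoundedContinuousFunction.mkOfCompact f).compContinuous ψ
  map_one' := rfl
  map_mul' _ _ := rfl
  map_zero' := rfl
  map_add' _ _ := rfl
  commutes' _ := rfl
  map_star' _ := rfl

theorem continuous_pullback (ψ : C(X, Y)) : Continuous (pullback ψ) :=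
  BoundedContinuousFunction.continuous_compContinuous ψ

theorem continuous_pullbackOfCompact [CompactSpace Y] (ψ : C(X, Y)) :
    Continuous (pullbackOfCompact ψ) :=
  (BoundedContinuousFunction.continuous_compContinuous ψ).comp
    (ContinuousMap.isometryEquivBoundedOfCompact Y ℂ).continuous

end Pullback

/-! ### Maps that preserve the resolvent algebra, and functions that belong to it. -/

section Algebra

variable {X : Type*} [NormedAddCommGroup X] [InnerProductSpace ℝ X]

theorem isClosed_resolventAlgebra :
    IsClosed (resolventAlgebra X : Set (X →ᵇ ℂ)) :=
  StarSubalgebra.isClosed_topologicalClosure _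

theorem classicalResolvent_mem (x : X) (c : ℝ) (hc : c ≠ 0) :
    classicalResolvent x c hc ∈ resolventAlgebra X :=
  StarSubalgebra.le_topologicalClosure _ (StarAlgebra.subset_adjoin _ _ ⟨x, c, hc, rfl⟩)

theorem classicalResolvent_apply (x : X) (c : ℝ) (hc : c ≠ 0) (y : X) :
    classicalResolvent x c hc y = 1 / (Complex.I * (c : ℂ) - ((inner ℝ x y : ℝ) : ℂ)) := rfl

/-- `ψ` is continuous and the pull-back along `ψ` maps `C_R(X)` into itself. -/
def PreservesResolventAlgebra (ψ : X → X) : Prop :=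
  ∃ h : Continuous ψ, ∀ f ∈ resolventAlgebra X, f.compContinuous ⟨ψ, h⟩ ∈ resolventAlgebra X

/-- The pull-back is a continuous star-homomorphism and the algebra is closed, so generators
suffice. -/
theorem PreservesResolventAlgebra.of_classicalResolvent {ψ : X → X} (h : Continuous ψ)
    (H : ∀ (x : X) (c : ℝ) (hc : c ≠ 0),
      (classicalResolvent x c hc).compContinuous ⟨ψ, h⟩ ∈ resolventAlgebra X) :
    PreservesResolventAlgebra ψ := by
  refine ⟨h, ?_⟩
  have key : resolventAlgebra X ≤ (resolventAlgebra X).comap (pullback ⟨ψ, h⟩) := by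
    refine StarSubalgebra.topologicalClosure_minimal ?_
      (isClosed_resolventAlgebra.preimage (continuous_pullback _))
    refine StarAlgebra.adjoin_le ?_
    rintro _ ⟨x, c, hc, rfl⟩
    exact H x c hc
  exact fun f hf => key hf

theorem PreservesResolventAlgebra.id : PreservesResolventAlgebra (id : X → X) :=
  ⟨continuous_id, fun _ hf => hf⟩

theorem PreservesResolventAlgebra.comp {φ ψ : X → X} (hφ : PreservesResolventAlgebra φ)
    (hψ : PreservesResolventAlgebra ψ) : PreservesResolventAlgebra (φ ∘ ψ) :=
  ⟨hφ.1.comp hψ.1, fun f hf => hψ.2 _ (hφ.2 f hf)⟩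

theorem PreservesResolventAlgebra.iterate {ψ : X → X} (hψ : PreservesResolventAlgebra ψ) (N : ℕ) :
    PreservesResolventAlgebra (ψ^[N]) := by
  induction N with
  | zero => exact .id
  | succ N ih => exact ih.comp hψ

theorem PreservesResolventAlgebra.continuousLinearMap [CompleteSpace X] (T : X →L[ℝ] X) :
    PreservesResolventAlgebra T := by
  refine .of_classicalResolvent T.continuous fun x c hc => ?_
  convert classicalResolvent_mem (ContinuousLinearMap.adjoint T x) c hc using 1
  ext y
  simp [classicalResolvent_apply, ContinuousLinearMap.adjoint_inner_left]

/-- `f` is the underlying function of an element of `C_R(X)`. -/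
def IsResolventFunction (f : X → ℂ) : Prop :=
  ∃ F ∈ resolventAlgebra X, ⇑F = f

theorem IsResolventFunction.sum {ι : Type*} (s : Finset ι) {f : ι → X → ℂ}
    (hf : ∀ i ∈ s, IsResolventFunction (f i)) :
    IsResolventFunction (fun z => ∑ i ∈ s, f i z) := by
  classical
  induction s using Finset.induction_on with
  | empty => exact ⟨0, zero_mem _, by ext; simp⟩
  | insert a s ha ih =>
    obtain ⟨F, hF, hFf⟩ := ih fun i hi => hf i (Finset.mem_insert_of_mem hi)
    obtain ⟨G, hG, hGf⟩ := hf a (Finset.mem_insert_self a s)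
    refine ⟨G + F, add_mem hG hF, ?_⟩
    ext z
    simp [Finset.sum_insert ha, ← hGf, congrFun hFf z]

/-- A translation by a displacement whose components lie in `C_R(X)` preserves `C_R(X)`. -/
theorem PreservesResolventAlgebra.id_add {D : X → X} (hD : Continuous D)
    (h : ∀ x : X, IsResolventFunction (fun z => ((inner ℝ x (D z) : ℝ) : ℂ))) :
    PreservesResolventAlgebra (fun z => z + D z) := by
  refine .of_classicalResolvent (continuous_id.add hD) fun x c hc => ?_
  obtain ⟨d, hd, hdD⟩ := h x
  have hdD' : ∀ z, d z = ((inner ℝ x (D z) : ℝ) : ℂ) := fun z => congrFun hdD z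
  set r := classicalResolvent x c hc with hr
  set r' := r.compContinuous ⟨fun z => z + D z, continuous_id.add hD⟩ with hr'
  have hr_mem : r ∈ resolventAlgebra X := classicalResolvent_mem x c hc
  have hu_mem : 1 - r * d ∈ resolventAlgebra X := sub_mem (one_mem _) (mul_mem hr_mem hd)
  -- Both identities are forms of the resolvent identity `r' - r = r * r' * d`.
  have h1 : (1 - r * d) * (1 + r' * d) = 1 := by
    ext z
    have e1 := resolvent_denom_ne_zero hc (inner ℝ x z)
    have e2 := resolvent_denom_ne_zero hc (inner ℝ x (z + D z))
    simp only [hr', hr, BoundedContinuousFunction.coe_mul, BoundedContinuousFunction.coe_sub,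
      BoundedContinuousFunction.coe_add, BoundedContinuousFunction.coe_one, Pi.mul_apply,
      Pi.sub_apply, Pi.add_apply, Pi.one_apply, BoundedContinuousFunction.compContinuous_apply,
      ContinuousMap.coe_mk, classicalResolvent_apply, hdD']
    rw [inner_add_right] at e2 ⊢
    push_cast at e2 ⊢
    field_simp
    ring
  have h2 : r = r' * (1 - r * d) := by
    ext z
    have e1 := resolvent_denom_ne_zero hc (inner ℝ x z)
    have e2 := resolvent_denom_ne_zero hc (inner ℝ x (z + D z))
    simp only [hr', hr, BoundedContinuousFunction.coe_mul, BoundedContinuousFunction.coe_sub,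
      BoundedContinuousFunction.coe_one, Pi.mul_apply,
      Pi.sub_apply, Pi.one_apply, BoundedContinuousFunction.compContinuous_apply,
      ContinuousMap.coe_mk, classicalResolvent_apply, hdD']
    rw [inner_add_right] at e2 ⊢
    push_cast at e2 ⊢
    field_simp
    ring
  -- The inverse `1 + r' * d` involves the unknown `r'`. Spectral permanence for closed
  -- star-subalgebras places it in the algebra without any smallness of `d`.
  have : IsClosed (resolventAlgebra X : Set (X →ᵇ ℂ)) := isClosed_resolventAlgebra
  have hunit : IsUnit ((⟨1 - r * d, hu_mem⟩ : resolventAlgebra X) : X →ᵇ ℂ) :=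
    IsUnit.of_mul_eq_one _ h1
  rw [StarSubalgebra.coe_isUnit] at hunit
  obtain ⟨w, hw⟩ := hunit.exists_right_inv
  have hw' : (1 - r * d) * (w : X →ᵇ ℂ) = 1 := congrArg Subtype.val hw
  have : r' = r * w := by
    calc r' = r' * ((1 - r * d) * w) := by rw [hw', mul_one]
      _ = r * w := by rw [← mul_assoc, ← h2]
  rw [this]
  exact mul_mem hr_mem w.2

theorem norm_resolvent_sub_le {c : ℝ} (hc : c ≠ 0) (a b : ℝ) :
    ‖1 / (Complex.I * (c : ℂ) - (a : ℂ)) - 1 / (Complex.I * (c : ℂ) - (b : ℂ))‖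
      ≤ 1 / |c| * (1 / |c|) * |a - b| := by
  have e1 := resolvent_denom_ne_zero hc a
  have e2 := resolvent_denom_ne_zero hc b
  have : 1 / (Complex.I * (c : ℂ) - (a : ℂ)) - 1 / (Complex.I * (c : ℂ) - (b : ℂ))
      = 1 / (Complex.I * (c : ℂ) - (a : ℂ)) * (1 / (Complex.I * (c : ℂ) - (b : ℂ)))
        * ((a - b : ℝ) : ℂ) := by
    push_cast
    field_simp
    ring
  rw [this, norm_mul, norm_mul, Complex.norm_real, Real.norm_eq_abs]
  gcongr
  · exact norm_resolvent_le hc a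
  · exact norm_resolvent_le hc b

/-- Resolvents are Lipschitz, so uniform convergence of the maps gives norm convergence of the
pulled-back generators. -/
theorem PreservesResolventAlgebra.of_tendsto {ψ : X → X} (hψ : Continuous ψ) {S : ℕ → X → X}
    (hS : ∀ N, PreservesResolventAlgebra (S N)) {u : ℕ → ℝ} (hu : Tendsto u atTop (𝓝 0))
    (hSu : ∀ᶠ N in atTop, ∀ z, ‖ψ z - S N z‖ ≤ u N) : PreservesResolventAlgebra ψ := by
  refine .of_classicalResolvent hψ fun x c hc => ?_
  set C := 1 / |c| * (1 / |c|) * ‖x‖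
  have hlim : Tendsto
      (fun N => (classicalResolvent x c hc).compContinuous ⟨S N, (hS N).1⟩) atTop
      (𝓝 ((classicalResolvent x c hc).compContinuous ⟨ψ, hψ⟩)) := by
    rw [tendsto_iff_norm_sub_tendsto_zero]
    have hCu : Tendsto (fun N => C * |u N|) atTop (𝓝 0) := by
      simpa using (hu.abs).const_mul C
    refine squeeze_zero' (.of_forall fun _ => norm_nonneg _) ?_ hCu
    filter_upwards [hSu] with N hN
    refine (BoundedContinuousFunction.norm_le (by positivity)).2 fun z => ?_
    simp only [BoundedContinuousFunction.coe_sub, Pi.sub_apply,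
      BoundedContinuousFunction.compContinuous_apply, ContinuousMap.coe_mk,
      classicalResolvent_apply]
    refine (norm_resolvent_sub_le hc _ _).trans ?_
    have h1 : |inner ℝ x (S N z) - inner ℝ x (ψ z)| ≤ ‖x‖ * |u N| := by
      rw [← inner_sub_right]
      refine (abs_real_inner_le_norm _ _).trans ?_
      gcongr
      rw [norm_sub_rev]
      exact (hN z).trans (le_abs_self _)
    calc _ ≤ 1 / |c| * (1 / |c|) * (‖x‖ * |u N|) := by gcongr
      _ = C * |u N| := by ring
  exact isClosed_resolventAlgebra.mem_of_tendsto hlim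
    (.of_forall fun N => (hS N).2 _ (classicalResolvent_mem x c hc))

/-- Functions vanishing at infinity extend by zero along open embeddings. -/
theorem continuous_extend_zero {A B : Type*} [TopologicalSpace A] [TopologicalSpace B] [T2Space B]
    {e : A → B} (he : IsOpenEmbedding e) {f : A → ℂ} (hf : Continuous f)
    (h0 : Tendsto f (cocompact A) (𝓝 0)) :
    Continuous (Function.extend e f (fun _ => 0)) := by
  rw [continuous_iff_continuousAt]
  intro y
  by_cases hy : y ∈ range e
  · obtain ⟨a, rfl⟩ := hy
    rw [← he.continuousAt_iff, Function.extend_comp he.injective]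
    exact hf.continuousAt
  · have hy0 : Function.extend e f (fun _ => 0) y = 0 :=
      Function.extend_apply' f (fun _ => (0 : ℂ)) y hy
    rw [ContinuousAt, hy0, Metric.tendsto_nhds]
    intro ε hε
    have h1 := (Metric.tendsto_nhds.1 h0) ε hε
    obtain ⟨K, hK, hKε⟩ := mem_cocompact.1 h1
    have hcl : IsClosed (e '' K) := (hK.image he.continuous).isClosed
    have : (e '' K)ᶜ ∈ 𝓝 y := hcl.isOpen_compl.mem_nhds fun h => hy (image_subset_range _ _ h)
    filter_upwards [this] with y' hy'
    by_cases hr : y' ∈ range e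
    · obtain ⟨a, rfl⟩ := hr
      rw [he.injective.extend_apply]
      exact hKε fun ha => hy' (mem_image_of_mem _ ha)
    · have h3 : Function.extend e f (fun _ => 0) y' = 0 :=
        Function.extend_apply' f (fun _ => (0 : ℂ)) y' hr
      rw [h3, dist_self]
      exact hε

theorem tendsto_resolvent_cocompact :
    Tendsto (fun t : ℝ => 1 / (Complex.I * ((1 : ℝ) : ℂ) - (t : ℂ))) (cocompact ℝ) (𝓝 0) := by
  rw [tendsto_zero_iff_norm_tendsto_zero]
  have h := (tendsto_norm_cocompact_atTop (E := ℝ)).inv_tendsto_atTop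
  refine squeeze_zero' (.of_forall fun _ => norm_nonneg _) ?_ h
  have hne : ∀ᶠ t : ℝ in cocompact ℝ, 0 < ‖t‖ :=
    (tendsto_norm_cocompact_atTop (E := ℝ)).eventually_gt_atTop 0
  filter_upwards [hne] with t ht
  rw [norm_div, norm_one, one_div, Pi.inv_apply]
  refine inv_anti₀ ht ?_
  simpa using Complex.abs_re_le_norm (Complex.I * ((1 : ℝ) : ℂ) - (t : ℂ))

/-- The resolvent `t ↦ 1 / (i - t)` on the one point compactification of the line. -/
noncomputable def resolventOnePoint : C(OnePoint ℝ, ℂ) :=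
  OnePoint.continuousMapMk
    ⟨fun t : ℝ => 1 / (Complex.I * ((1 : ℝ) : ℂ) - (t : ℂ)),
      continuous_const.div (continuous_const.sub Complex.continuous_ofReal)
        fun t => resolvent_denom_ne_zero one_ne_zero t⟩
    0 (coclosedCompact_eq_cocompact (X := ℝ) ▸ tendsto_resolvent_cocompact)

theorem resolventOnePoint_coe (t : ℝ) :
    resolventOnePoint (t : OnePoint ℝ) = 1 / (Complex.I * ((1 : ℝ) : ℂ) - (t : ℂ)) := rfl

theorem resolventOnePoint_injective : Function.Injective resolventOnePoint := by
  have hne : ∀ t : ℝ, resolventOnePoint (t : OnePoint ℝ) ≠ 0 := fun t => by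
    rw [resolventOnePoint_coe]
    exact one_div_ne_zero (resolvent_denom_ne_zero one_ne_zero t)
  intro a b hab
  induction a using OnePoint.rec with
  | infty =>
    induction b using OnePoint.rec with
    | infty => rfl
    | coe t => exact absurd hab.symm (hne t)
  | coe s =>
    induction b using OnePoint.rec with
    | infty => exact absurd hab (hne s)
    | coe t =>
      rw [resolventOnePoint_coe, resolventOnePoint_coe, one_div, one_div, inv_inj] at hab
      have : s = t := by simpa using hab
      rw [this]

/-- A function of finitely many linear coordinates that vanishes at infinity in these coordinates
belongs to the commutative resolvent algebra. -/
theorem isResolventFunction_of_tendsto_zero {ι : Type*} [Fintype ι] (b : ι → X)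
    {f : (ι → ℝ) → ℂ} (hf : Continuous f) (h0 : Tendsto f (cocompact _) (𝓝 0)) :
    IsResolventFunction (fun z : X => f fun j => inner ℝ (b j) z) := by
  -- Each coordinate is compactified separately, so that a resolvent of one coordinate extends
  -- continuously. These extensions separate points, and Stone–Weierstrass applies on the compact
  -- product.
  set e : (ι → ℝ) → (ι → OnePoint ℝ) := Pi.map fun _ t => (t : OnePoint ℝ) with he_def
  have he : IsOpenEmbedding e := IsOpenEmbedding.piMap fun _ => OnePoint.isOpenEmbedding_coe
  have hρ : Continuous fun z : X => e fun j => inner ℝ (b j) z :=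
    he.continuous.comp (by fun_prop)
  set ρ : C(X, ι → OnePoint ℝ) := ⟨_, hρ⟩ with hρ_def
  set A : StarSubalgebra ℂ C(ι → OnePoint ℝ, ℂ) :=
    (resolventAlgebra X).comap (pullbackOfCompact ρ) with hA
  have hAcl : IsClosed (A : Set C(ι → OnePoint ℝ, ℂ)) :=
    isClosed_resolventAlgebra.preimage (continuous_pullbackOfCompact ρ)
  have hsep : A.SeparatesPoints := by
    intro y y' hyy'
    obtain ⟨j, hj⟩ := Function.ne_iff.1 hyy'
    let F : C(ι → OnePoint ℝ, ℂ) :=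
      resolventOnePoint.comp ⟨fun y => y j, continuous_apply j⟩
    refine ⟨F, ⟨F, ?_, rfl⟩, fun h => hj (resolventOnePoint_injective h)⟩
    change pullbackOfCompact ρ F ∈ resolventAlgebra X
    exact classicalResolvent_mem (b j) 1 one_ne_zero
  have htop : A = ⊤ := by
    rw [← ContinuousMap.starSubalgebra_topologicalClosure_eq_top_of_separatesPoints A hsep]
    exact le_antisymm (StarSubalgebra.le_topologicalClosure _)
      (StarSubalgebra.topologicalClosure_minimal le_rfl hAcl)
  let G : C(ι → OnePoint ℝ, ℂ) := ⟨_, continuous_extend_zero he hf h0⟩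
  have hG : G ∈ A := htop ▸ StarSubalgebra.mem_top
  refine ⟨pullbackOfCompact ρ G, hG, ?_⟩
  ext z
  exact he.injective.extend_apply f (fun _ => 0) fun j => inner ℝ (b j) z

end Algebra

/-! ### Time averages along analytic families of linear maps. -/

section TimeAverage

variable {E F G : Type*} [NormedAddCommGroup E] [InnerProductSpace ℝ E]
  [NormedAddCommGroup F] [NormedSpace ℝ F] [NormedAddCommGroup G] [NormedSpace ℝ G]

theorem continuous_timeAverage {T : ℝ → E →L[ℝ] F} (hT : Continuous T) {g : F → G}
    (hg : Continuous g) {β : ℝ → G →L[ℝ] ℝ} (hβ : Continuous β) (h : ℝ) :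
    Continuous fun z : E => ∫ s in (0 : ℝ)..h, β s (g (T s z)) := by
  refine intervalIntegral.continuous_parametric_intervalIntegral_of_continuous' ?_ 0 h
  have h1 : Continuous fun p : E × ℝ => T p.2 p.1 :=
    (hT.comp continuous_snd).clm_apply continuous_fst
  exact (hβ.comp continuous_snd).clm_apply (hg.comp h1)

variable [FiniteDimensional ℝ E]

/-- Time averages of `g (T s w)` tend to zero as `w` escapes to infinity in a subspace that contains
no nonzero vector annihilated by all the `T s`. -/
theorem tendsto_timeAverage_cocompact {T : ℝ → E →L[ℝ] F} (hT : Continuous T)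
    (hTan : ∀ z, AnalyticOnNhd ℝ (fun s => T s z) univ) {g : F → G}
    (hg : Continuous g) (hgc : HasCompactSupport g) {β : ℝ → G →L[ℝ] ℝ} (hβ : Continuous β)
    (h : ℝ) (W : Submodule ℝ E) (hW : ∀ z ∈ W, (∀ s, T s z = 0) → z = 0) :
    Tendsto (fun w : W => ∫ s in (0 : ℝ)..h, β s (g (T s w))) (cocompact W) (𝓝 0) := by
  have : (cocompact W).IsCountablyGenerated := by
    rw [← Metric.cobounded_eq_cocompact, ← comap_norm_atTop]
    infer_instance
  -- Along a subsequence the directions `w n / ‖w n‖` converge to a unit vector `u₀`, by compactness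
  -- of the unit ball.
  refine tendsto_of_subseq_tendsto fun w hw => ?_
  have hwn : Tendsto (fun n => ‖w n‖) atTop atTop := (tendsto_norm_cocompact_atTop (E := W)).comp hw
  have hpos : ∀ᶠ n in atTop, 0 < ‖w n‖ := hwn.eventually_gt_atTop 0
  set u : ℕ → W := fun n => ‖w n‖⁻¹ • w n with hu_def
  have hball : ∀ n, u n ∈ Metric.closedBall (0 : W) 1 := fun n => by
    rw [mem_closedBall_zero_iff, hu_def, norm_smul, norm_inv, norm_norm]
    exact inv_mul_le_one
  obtain ⟨u₀, -, ms, hms, hlim⟩ := (isCompact_closedBall (0 : W) 1).tendsto_subseq hball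
  have hu₀ : ‖u₀‖ = 1 := by
    refine tendsto_nhds_unique hlim.norm ?_
    refine tendsto_const_nhds.congr' ?_
    filter_upwards [hms.tendsto_atTop.eventually hpos] with n hn
    simp only [Function.comp_apply, hu_def, norm_smul, norm_inv, norm_norm]
    exact (inv_mul_cancel₀ hn.ne').symm
  have hne : ∃ s, T s u₀ ≠ 0 := by
    by_contra! hcon
    have : u₀ = 0 := Subtype.ext (hW u₀ u₀.2 hcon)
    simp [this] at hu₀
  obtain ⟨s₀, hs₀⟩ := hne
  -- The zeros of a nonzero analytic function are isolated, hence form a null set.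
  have hae : ∀ᵐ s : ℝ, T s u₀ ≠ 0 := by
    have h1 := (hTan u₀).preimage_zero_mem_codiscrete hs₀
    have h2 := ae_restrict_le_codiscreteWithin (μ := (MeasureTheory.volume : MeasureTheory.Measure ℝ))
      MeasurableSet.univ h1
    rwa [MeasureTheory.Measure.restrict_univ] at h2
  obtain ⟨M, hM⟩ := hgc.exists_bound_of_continuous hg
  refine ⟨ms, ?_⟩
  have hzero : (∫ _ in (0 : ℝ)..h, (0 : ℝ)) = 0 := by simp
  conv in 𝓝 _ => rw [← hzero]
  refine intervalIntegral.tendsto_integral_filter_of_dominated_convergence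
    (fun s => ‖β s‖ * M) (.of_forall fun n => ?_) (.of_forall fun n => .of_forall fun s _ => ?_)
    ((hβ.norm.mul continuous_const).intervalIntegrable _ _) ?_
  · exact (hβ.clm_apply (hg.comp (hT.clm_apply continuous_const))).aestronglyMeasurable
  · exact ((β s).le_opNorm _).trans (by gcongr; exact hM _)
  -- When `T s u₀ ≠ 0`, the points `T s (w (ms n))` escape to infinity and leave the support of `g`.
  · filter_upwards [hae] with s hs _
    have hinf : Tendsto (fun n => ‖T s (w (ms n))‖) atTop atTop := by
      have h1 : Tendsto (fun n => ‖T s (u (ms n))‖) atTop (𝓝 ‖T s u₀‖) :=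
        (((T s).continuous.comp continuous_subtype_val).norm.tendsto u₀).comp hlim
      have h2 := (hwn.comp hms.tendsto_atTop).atTop_mul_pos (norm_pos_iff.2 hs) h1
      refine h2.congr' ?_
      filter_upwards [hms.tendsto_atTop.eventually hpos] with n hn
      simp only [Function.comp_apply, hu_def, Submodule.coe_smul, map_smul, norm_smul, norm_inv,
        norm_norm]
      field_simp
    obtain ⟨R, hR⟩ := hgc.isCompact.isBounded.exists_norm_le
    refine tendsto_const_nhds.congr' ?_
    filter_upwards [hinf.eventually_gt_atTop R] with n hn
    have : g (T s (w (ms n))) = 0 :=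
      image_eq_zero_of_notMem_tsupport fun hmem => (hR _ hmem).not_gt hn
    simp [this]

/-- The average depends only on the component orthogonal to the common kernel `K` of the `T s`, and
on `Kᗮ` it vanishes at infinity. It is thus a function of orthonormal coordinates of `Kᗮ` to which
`isResolventFunction_of_tendsto_zero` applies. -/
theorem isResolventFunction_timeAverage {T : ℝ → E →L[ℝ] F} (hT : Continuous T)
    (hTan : ∀ z, AnalyticOnNhd ℝ (fun s => T s z) univ) {g : F → G}
    (hg : Continuous g) (hgc : HasCompactSupport g) {β : ℝ → G →L[ℝ] ℝ} (hβ : Continuous β)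
    (h : ℝ) :
    IsResolventFunction (fun z : E => ((∫ s in (0 : ℝ)..h, β s (g (T s z)) : ℝ) : ℂ)) := by
  set φ : E → ℝ := fun z => ∫ s in (0 : ℝ)..h, β s (g (T s z)) with hφ
  set K : Submodule ℝ E := ⨅ s, LinearMap.ker (T s : E →ₗ[ℝ] F) with hK
  have memK : ∀ z, z ∈ K ↔ ∀ s, T s z = 0 := fun z => by simp [hK, Submodule.mem_iInf]
  have hφK : ∀ z, φ z = φ (Kᗮ.starProjection z) := fun z => by
    have h1 : z - Kᗮ.starProjection z ∈ K := by
      have := Kᗮ.sub_starProjection_mem_orthogonal z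
      rwa [Submodule.orthogonal_orthogonal] at this
    have h2 : ∀ s, T s z = T s (Kᗮ.starProjection z) := fun s => by
      rw [← sub_eq_zero, ← map_sub]
      exact (memK _).1 h1 s
    simp only [hφ, h2]
  have hlim := tendsto_timeAverage_cocompact hT hTan hg hgc hβ h Kᗮ fun z hz hs => by
    have : z ∈ K ⊓ Kᗮ := ⟨(memK z).2 hs, hz⟩
    rwa [Submodule.inf_orthogonal_eq_bot, Submodule.mem_bot] at this
  set b := stdOrthonormalBasis ℝ Kᗮ
  set c := b.toBasis.equivFunL.symm
  have hf : Continuous fun t => ((φ (c t) : ℝ) : ℂ) :=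
    Complex.continuous_ofReal.comp ((continuous_timeAverage hT hg hβ h).comp
      (continuous_subtype_val.comp c.continuous))
  have h0 : Tendsto (fun t => ((φ (c t) : ℝ) : ℂ)) (cocompact _) (𝓝 0) := by
    have h1 := hlim.comp c.toHomeomorph.isClosedEmbedding.tendsto_cocompact
    exact (Complex.continuous_ofReal.tendsto' 0 0 (by simp)).comp h1
  convert isResolventFunction_of_tendsto_zero (fun j => (b j : E)) hf h0 using 3 with z
  refine (hφK z).trans (congrArg φ ?_)
  have : c (fun j => inner ℝ (b j : E) z) = Kᗮ.orthogonalProjectionOnto z := by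
    rw [← b.sum_repr (Kᗮ.orthogonalProjectionOnto z)]
    refine (b.toBasis.equivFun_symm_apply _).trans ?_
    simp [b.repr_apply_apply]
  rw [this]
  rfl

end TimeAverage

/-! ### Gluing local solutions. -/

section GlobalSolution

variable {E : Type*} [NormedAddCommGroup E] [NormedSpace ℝ E]

/-- Solutions of a Lipschitz equation on arbitrarily long intervals glue to a global solution. -/
theorem exists_global_solution_of_forall_Ioo {v : E → E} {K : ℝ≥0} (hv : LipschitzWith K v) {z : E}
    (H : ∀ T > 0, ∃ γ : ℝ → E, γ 0 = z ∧ ∀ t ∈ Ioo (-T) T, HasDerivAt γ (v (γ t)) t) :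
    ∃ γ : ℝ → E, γ 0 = z ∧ ∀ t, HasDerivAt γ (v (γ t)) t := by
  choose γ hγ0 hγ using fun n : ℕ => H (n + 1) n.cast_add_one_pos
  have hmono : ∀ {m n : ℕ}, m ≤ n → EqOn (γ m) (γ n) (Ioo (-(m + 1 : ℝ)) (m + 1)) := by
    intro m n hmn
    have hmn' : (m : ℝ) ≤ n := Nat.cast_le.2 hmn
    have hm := m.cast_add_one_pos (α := ℝ)
    refine ODE_solution_unique_of_mem_Ioo (v := fun _ => v) (s := fun _ => univ) (K := K) (t₀ := 0)
      (fun t _ => hv.lipschitzOnWith) ⟨by linarith, hm⟩ (fun t ht => ⟨hγ m t ht, trivial⟩)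
      (fun t ht => ⟨hγ n t ⟨?_, ?_⟩, trivial⟩) ((hγ0 m).trans (hγ0 n).symm)
    · linarith [ht.1]
    · linarith [ht.2]
  refine ⟨fun t => γ ⌈|t|⌉₊ t, hγ0 _, fun t₀ => ?_⟩
  have hmem : ∀ t : ℝ, t ∈ Ioo (-(⌈|t|⌉₊ + 1 : ℝ)) (⌈|t|⌉₊ + 1) := fun t => by
    rw [mem_Ioo, ← abs_lt]
    linarith [Nat.le_ceil |t|]
  -- The extra `1` covers nearby `t` whose ceiling exceeds that of `|t₀|`.
  have heq : (fun t => γ ⌈|t|⌉₊ t) =ᶠ[𝓝 t₀] γ (⌈|t₀|⌉₊ + 1) := by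
    have hlt : ∀ᶠ t in 𝓝 t₀, |t| < (⌈|t₀|⌉₊ : ℝ) + 1 :=
      continuous_abs.continuousAt.eventually_lt_const (by linarith [Nat.le_ceil |t₀|])
    filter_upwards [hlt] with t ht
    refine hmono ?_ (hmem t)
    exact Nat.ceil_le.2 (by exact_mod_cast ht.le)
  have h1 := hγ (⌈|t₀|⌉₊ + 1) t₀ (by
    have := hmem t₀
    push_cast
    constructor <;> linarith [this.1, this.2])
  rw [← heq.eq_of_nhds] at h1
  exact h1.congr_of_eventuallyEq heq

end GlobalSolution

/-! ### Linear flow, interaction picture and the one-step error. -/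

section LinearFlow

variable {E : Type*} [NormedAddCommGroup E] [NormedSpace ℝ E]

/-- The flow `exp (s A)` of the linear equation `z' = A z`. -/
noncomputable def linearFlow (A : E →L[ℝ] E) (s : ℝ) : E →L[ℝ] E := NormedSpace.exp (s • A)

theorem linearFlow_zero (A : E →L[ℝ] E) : linearFlow A 0 = 1 := by
  rw [linearFlow, zero_smul, NormedSpace.exp_zero]

/-- The perturbation `Y` in the interaction picture of the linear flow of `A`. -/
noncomputable def interactionField (A : E →L[ℝ] E) (Y : E → E) (s : ℝ) (z : E) : E :=
  linearFlow A (-s) (Y (linearFlow A s z))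

variable {A : E →L[ℝ] E} {Y : E → E} {K : ℝ≥0} {M : ℝ} {C : ℝ≥0} {T : ℝ}

/-- This bound and the next Lipschitz constant do not depend on `z`, although `A z` is unbounded;
hence the interaction picture. -/
theorem norm_interactionField_le (hM : ∀ z, ‖Y z‖ ≤ M)
    (hC : ∀ s, |s| ≤ T → ‖linearFlow A s‖ ≤ C) {s : ℝ} (hs : |s| ≤ T) (z : E) :
    ‖interactionField A Y s z‖ ≤ C * M :=
  (ContinuousLinearMap.le_opNorm _ _).trans
    (mul_le_mul (hC _ (by rwa [abs_neg])) (hM _) (norm_nonneg _) C.2)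

theorem lipschitzWith_interactionField (hY : LipschitzWith K Y)
    (hC : ∀ s, |s| ≤ T → ‖linearFlow A s‖ ≤ C) {s : ℝ} (hs : |s| ≤ T) :
    LipschitzWith (C * (K * C)) (interactionField A Y s) :=
  ((linearFlow A (-s)).lipschitz.weaken (hC _ (by rwa [abs_neg]))).comp
    (hY.comp ((linearFlow A s).lipschitz.weaken (hC _ hs)))

theorem lipschitzWith_add_perturbation (hY : LipschitzWith K Y) :
    LipschitzWith (‖A‖₊ + K) (fun z => A z + Y z) :=
  A.lipschitz.add hY

variable [CompleteSpace E]

theorem hasDerivAt_linearFlow (A : E →L[ℝ] E) (s : ℝ) :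
    HasDerivAt (linearFlow A) (linearFlow A s * A) s :=
  hasDerivAt_exp_smul_const A s

theorem hasDerivAt_linearFlow' (A : E →L[ℝ] E) (s : ℝ) :
    HasDerivAt (linearFlow A) (A * linearFlow A s) s :=
  hasDerivAt_exp_smul_const' A s

theorem continuous_linearFlow (A : E →L[ℝ] E) : Continuous (linearFlow A) :=
  continuous_iff_continuousAt.2 fun s => (hasDerivAt_linearFlow A s).continuousAt

theorem linearFlow_neg_mul (A : E →L[ℝ] E) (s : ℝ) : linearFlow A (-s) * linearFlow A s = 1 := by
  let _ : NormedAlgebra ℚ (E →L[ℝ] E) := NormedAlgebra.restrictScalars ℚ ℝ _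
  rw [linearFlow, linearFlow, ← NormedSpace.exp_add_of_commute, neg_smul, neg_add_cancel,
    NormedSpace.exp_zero]
  exact ((Commute.refl A).smul_left _).smul_right _

theorem linearFlow_neg_apply (A : E →L[ℝ] E) (s : ℝ) (z : E) :
    linearFlow A (-s) (linearFlow A s z) = z :=
  congrArg (fun T : E →L[ℝ] E => T z) (linearFlow_neg_mul A s)

theorem linearFlow_apply_neg (A : E →L[ℝ] E) (s : ℝ) (z : E) :
    linearFlow A s (linearFlow A (-s) z) = z := by
  simpa using linearFlow_neg_apply A (-s) z

theorem analyticOnNhd_linearFlow {F : Type*} [NormedAddCommGroup F] [NormedSpace ℝ F]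
    (A : E →L[ℝ] E) (L : E →L[ℝ] F) (z : E) :
    AnalyticOnNhd ℝ (fun s => L (linearFlow A s z)) univ := fun s _ => by
  have h1 : AnalyticAt ℝ (linearFlow A) s :=
    AnalyticAt.comp (f := fun r : ℝ => r • A) (NormedSpace.exp_analytic (𝕂 := ℝ) (s • A))
      (analyticAt_id.smul analyticAt_const)
  exact ((L.comp (ContinuousLinearMap.apply ℝ E z)).analyticAt (linearFlow A s)).comp h1

theorem exists_norm_linearFlow_le (A : E →L[ℝ] E) (T : ℝ) :
    ∃ C : ℝ≥0, ∀ s, |s| ≤ T → ‖linearFlow A s‖ ≤ C := by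
  obtain ⟨C, hC⟩ := (isCompact_Icc (a := -T) (b := T)).exists_bound_of_continuousOn
    (continuous_linearFlow A).continuousOn
  exact ⟨C.toNNReal, fun s hs => (hC s (abs_le.1 hs)).trans (Real.le_coe_toNNReal C)⟩

theorem continuous_interactionField (A : E →L[ℝ] E) (hY : Continuous Y) :
    Continuous fun p : E × ℝ => interactionField A Y p.2 p.1 :=
  ((continuous_linearFlow A).comp continuous_snd.neg).clm_apply
    (hY.comp (((continuous_linearFlow A).comp continuous_snd).clm_apply continuous_fst))

theorem continuous_interactionField_left (A : E →L[ℝ] E) (hY : Continuous Y) (z : E) :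
    Continuous fun s => interactionField A Y s z :=
  (continuous_interactionField A hY).comp (continuous_const.prodMk continuous_id)

/-- Passage from the interaction picture to the perturbed linear equation. -/
theorem hasDerivAt_linearFlow_apply {w : ℝ → E} {t : ℝ}
    (hw : HasDerivAt w (interactionField A Y t (w t)) t) :
    HasDerivAt (fun s => linearFlow A s (w s))
      (A (linearFlow A t (w t)) + Y (linearFlow A t (w t))) t := by
  have := (hasDerivAt_linearFlow' A t).clm_apply hw
  rwa [interactionField, linearFlow_apply_neg] at this

/-- Passage from the perturbed linear equation to the interaction picture. -/
theorem hasDerivAt_linearFlow_neg_apply {γ : ℝ → E} {t : ℝ}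
    (hγ : HasDerivAt γ (A (γ t) + Y (γ t)) t) :
    HasDerivAt (fun s => linearFlow A (-s) (γ s))
      (interactionField A Y t (linearFlow A (-t) (γ t))) t := by
  have h1 : HasDerivAt (fun s => linearFlow A (-s)) ((-1 : ℝ) • (linearFlow A (-t) * A)) t :=
    (hasDerivAt_linearFlow A (-t)).scomp t (hasDerivAt_neg t)
  have h2 := h1.clm_apply hγ
  rw [interactionField, linearFlow_apply_neg]
  convert h2 using 1
  simp

/-- A linear equation with a bounded Lipschitz perturbation has global solutions. -/
theorem exists_global_solution (hY : LipschitzWith K Y) (hM : ∀ z, ‖Y z‖ ≤ M) (z : E) :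
    ∃ γ : ℝ → E, γ 0 = z ∧ ∀ t, HasDerivAt γ (A (γ t) + Y (γ t)) t := by
  refine exists_global_solution_of_forall_Ioo (lipschitzWith_add_perturbation hY) fun T hT => ?_
  obtain ⟨C, hC⟩ := exists_norm_linearFlow_le A T
  have hM0 : 0 ≤ M := (norm_nonneg _).trans (hM 0)
  lift M to ℝ≥0 using hM0
  lift T to ℝ≥0 using hT.le
  -- A curve of speed at most `C * M` stays in the ball of radius `C * M * T` up to time `T`, so
  -- Picard–Lindelöf covers the whole interval.
  have hPL : IsPicardLindelof (interactionField A Y) (tmin := -T) (tmax := T)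
      ⟨0, by simp, by simp⟩ z (C * M * T) 0 (C * M) (C * (K * C)) := by
    refine ⟨fun t ht => ?_, fun x _ => ?_, fun t ht x _ => ?_, ?_⟩
    · exact (lipschitzWith_interactionField hY hC (abs_le.2 ht)).lipschitzOnWith
    · exact (continuous_interactionField_left A hY.continuous x).continuousOn
    · exact_mod_cast norm_interactionField_le hM hC (abs_le.2 ht) x
    · simp
  obtain ⟨w, hw0, hw⟩ := hPL.exists_eq_forall_mem_Icc_hasDerivWithinAt₀
  refine ⟨fun s => linearFlow A s (w s), ?_, fun t ht => ?_⟩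
  · simp [linearFlow_zero, hw0]
  · exact hasDerivAt_linearFlow_apply
      ((hw t (Ioo_subset_Icc_self ht)).hasDerivAt (Icc_mem_nhds ht.1 ht.2))

/-- The exact flow and the linear flow composed with one averaged Euler step differ by a quadratic
error. -/
theorem norm_solution_sub_averaged_step_le (hY : LipschitzWith K Y) (hM : ∀ z, ‖Y z‖ ≤ M)
    (hC : ∀ s, |s| ≤ T → ‖linearFlow A s‖ ≤ C) {γ : ℝ → E}
    (hγ : ∀ t, HasDerivAt γ (A (γ t) + Y (γ t)) t) {h : ℝ} (h0 : 0 ≤ h) (hT : h ≤ T) :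
    ‖γ h - linearFlow A h (γ 0 + ∫ s in (0 : ℝ)..h, interactionField A Y s (γ 0))‖
      ≤ C * (C * (K * C) * (C * M)) * h ^ 2 := by
  set w : ℝ → E := fun s => linearFlow A (-s) (γ s) with hw_def
  have hw : ∀ t, HasDerivAt w (interactionField A Y t (w t)) t := fun t =>
    hasDerivAt_linearFlow_neg_apply (hγ t)
  have hw0 : w 0 = γ 0 := by simp [hw_def, linearFlow_zero]
  have hM0 : 0 ≤ M := (norm_nonneg _).trans (hM 0)
  have habs : ∀ s ∈ Icc 0 h, |s| ≤ T := fun s hs => by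
    rw [abs_of_nonneg hs.1]
    exact hs.2.trans hT
  have h1 : ∀ s ∈ Icc 0 h, ‖w s - w 0‖ ≤ C * M * (s - 0) :=
    norm_image_sub_le_of_norm_deriv_le_segment' (fun s _ => (hw s).hasDerivWithinAt)
      fun s hs => norm_interactionField_le hM hC (habs s (Ico_subset_Icc_self hs)) _
  -- The derivative of `D` compares the field at `w s` and at `w 0`. These points are at distance at
  -- most `C * M * h`, so integration over `[0, h]` supplies the second factor `h`.
  set D : ℝ → E := fun s => w s - ∫ r in (0 : ℝ)..s, interactionField A Y r (γ 0) with hD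
  have hDderiv : ∀ s, HasDerivAt D
      (interactionField A Y s (w s) - interactionField A Y s (γ 0)) s := fun s => by
    have hc := continuous_interactionField_left A hY.continuous (γ 0)
    exact (hw s).sub (intervalIntegral.integral_hasDerivAt_right (hc.intervalIntegrable _ _)
      (hc.stronglyMeasurableAtFilter _ _) hc.continuousAt)
  have h2 : ∀ s ∈ Icc 0 h, ‖D s - D 0‖ ≤ C * (K * C) * (C * M * h) * (s - 0) := by
    refine norm_image_sub_le_of_norm_deriv_le_segment' (fun s _ => (hDderiv s).hasDerivWithinAt)
      fun s hs => ?_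
    have hs' := Ico_subset_Icc_self hs
    refine ((lipschitzWith_interactionField hY hC (habs s hs')).norm_sub_le _ _).trans ?_
    push_cast
    gcongr
    rw [← hw0]
    refine (h1 s hs').trans ?_
    rw [sub_zero]
    gcongr
    exact hs'.2
  have h3 := h2 h ⟨h0, le_rfl⟩
  have h4 : γ h - linearFlow A h (γ 0 + ∫ s in (0 : ℝ)..h, interactionField A Y s (γ 0))
      = linearFlow A h (D h - D 0) := by
    simp only [hD, intervalIntegral.integral_same, sub_zero, map_sub, map_add, hw_def,
      linearFlow_apply_neg, neg_zero, linearFlow_zero, one_apply_eq_self]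
    abel
  rw [h4]
  calc _ ≤ ‖linearFlow A h‖ * ‖D h - D 0‖ := ContinuousLinearMap.le_opNorm _ _
    _ ≤ C * (C * (K * C) * (C * M * h) * (h - 0)) := by
        gcongr
        exact hC h (habs h ⟨h0, le_rfl⟩)
    _ = _ := by ring

end LinearFlow

/-! ### Error accumulation and general facts on flows. -/

/-- Accumulation of the errors of an approximate one-step map. -/
theorem norm_flow_sub_iterate_le {E : Type*} [NormedAddCommGroup E] {Φ : ℝ → E → E}
    (h0 : ∀ z, Φ 0 z = z)
    (hadd : ∀ s t z, Φ (s + t) z = Φ s (Φ t z)) {S : E → E} {h δ κ T : ℝ} (hh : 0 ≤ h)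
    (hκ : ∀ s ∈ Icc 0 T, ∀ z z', ‖Φ s z - Φ s z'‖ ≤ κ * ‖z - z'‖) (hκ0 : 0 ≤ κ)
    (hS : ∀ z, ‖Φ h z - S z‖ ≤ δ) (N : ℕ) (hN : N * h ≤ T) (z : E) :
    ‖Φ (N * h) z - S^[N] z‖ ≤ N * (κ * δ) := by
  induction N generalizing z with
  | zero => simp [h0]
  | succ N ih =>
    have hN' : N * h ≤ T := by
      push_cast at hN
      linarith
    have e : Φ ((N + 1 : ℕ) * h) z = Φ (N * h) (Φ h z) := by
      rw [← hadd]
      push_cast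
      ring_nf
    rw [e, Function.iterate_succ_apply]
    -- The error of a step is propagated by the exact flow, so no Lipschitz bound on `S` is needed.
    calc _ ≤ ‖Φ (N * h) (Φ h z) - Φ (N * h) (S z)‖ + ‖Φ (N * h) (S z) - S^[N] (S z)‖ :=
          norm_sub_le_norm_sub_add_norm_sub _ _ _
      _ ≤ κ * δ + N * (κ * δ) := by
          gcongr
          · exact (hκ _ ⟨by positivity, hN'⟩ _ _).trans (by gcongr; exact hS z)
          · exact ih hN' _
      _ = _ := by push_cast; ring

section Flow

variable {E : Type*} [NormedAddCommGroup E] [NormedSpace ℝ E] {v : E → E} {K : ℝ≥0}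
  {Φ : ℝ → E → E}

theorem flow_add (hv : LipschitzWith K v) (h0 : ∀ z, Φ 0 z = z)
    (hΦ : ∀ z t, HasDerivAt (fun s => Φ s z) (v (Φ t z)) t) (s t : ℝ) (z : E) :
    Φ (s + t) z = Φ s (Φ t z) := by
  have := ODE_solution_unique_univ (v := fun _ => v) (s := fun _ => univ) (K := K) (t₀ := 0)
    (f := fun s => Φ (s + t) z) (g := fun s => Φ s (Φ t z))
    (fun _ => hv.lipschitzOnWith) (fun s => ⟨(hΦ z (s + t)).comp_add_const s t, trivial⟩)
    (fun s => ⟨hΦ _ s, trivial⟩) (by simp [h0])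
  exact congrFun this s

theorem norm_flow_sub_le (hv : LipschitzWith K v) (h0 : ∀ z, Φ 0 z = z)
    (hΦ : ∀ z t, HasDerivAt (fun s => Φ s z) (v (Φ t z)) t) {t : ℝ} (ht : 0 ≤ t) (z z' : E) :
    ‖Φ t z - Φ t z'‖ ≤ Real.exp (K * t) * ‖z - z'‖ := by
  have hcont : ∀ z, Continuous fun s => Φ s z := fun z =>
    continuous_iff_continuousAt.2 fun s => (hΦ z s).continuousAt
  have := dist_le_of_trajectories_ODE (v := fun _ => v) (K := K) (a := 0) (b := t)
    (δ := ‖z - z'‖) (fun _ => hv) (hcont z).continuousOn (fun s _ => (hΦ z s).hasDerivWithinAt)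
    (hcont z').continuousOn (fun s _ => (hΦ z' s).hasDerivWithinAt)
    (by rw [h0, h0, dist_eq_norm]) t ⟨ht, le_rfl⟩
  rwa [dist_eq_norm, sub_zero, mul_comm] at this

end Flow

/-- Pull-back along `Φ (-t)` provides preimages. -/
theorem image_resolventAlgebra_eq {E : Type*} [NormedAddCommGroup E] [InnerProductSpace ℝ E]
    {Φ : ℝ → E → E} (h0 : ∀ z, Φ 0 z = z)
    (hadd : ∀ s t z, Φ (s + t) z = Φ s (Φ t z)) (hΦ : ∀ t, PreservesResolventAlgebra (Φ t))
    (t : ℝ) : (fun f : E →ᵇ ℂ => f.compContinuous ⟨Φ t, (hΦ t).1⟩) ''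
      (resolventAlgebra E : Set (E →ᵇ ℂ)) = (resolventAlgebra E : Set (E →ᵇ ℂ)) := by
  refine Subset.antisymm (image_subset_iff.2 (hΦ t).2) fun f hf => ?_
  refine ⟨f.compContinuous ⟨Φ (-t), (hΦ (-t)).1⟩, (hΦ (-t)).2 f hf, ?_⟩
  ext z
  simp [← hadd, h0]

/-! ### Invariance of the resolvent algebra under the perturbed flow. -/

section Preservation

variable {E F ι : Type*} [NormedAddCommGroup E] [InnerProductSpace ℝ E] [FiniteDimensional ℝ E]
  [NormedAddCommGroup F] [NormedSpace ℝ F]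

theorem isResolventFunction_averaged_displacement (A : E →L[ℝ] E) (I : Finset ι)
    (B : ι → F →L[ℝ] E) (g : ι → F → F) (L : ι → E →L[ℝ] F) (hg : ∀ e, Continuous (g e))
    (hgc : ∀ e, HasCompactSupport (g e)) (h : ℝ) (x : E) :
    IsResolventFunction (fun z => ((inner ℝ x (∫ s in (0 : ℝ)..h,
      interactionField A (fun z => ∑ e ∈ I, B e (g e (L e z))) s z) : ℝ) : ℂ)) := by
  have hY : Continuous fun z => ∑ e ∈ I, B e (g e (L e z)) :=
    continuous_finsetSum _ fun e _ => (B e).continuous.comp ((hg e).comp (L e).continuous)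
  set T : ι → ℝ → E →L[ℝ] F := fun e s => (L e).comp (linearFlow A s)
  set β : ι → ℝ → F →L[ℝ] ℝ := fun e s => (innerSL ℝ x).comp ((linearFlow A (-s)).comp (B e))
  have hT : ∀ e, Continuous (T e) := fun e => continuous_const.clm_comp (continuous_linearFlow A)
  have hβ : ∀ e, Continuous (β e) := fun e => continuous_const.clm_comp
    (((continuous_linearFlow A).comp continuous_neg).clm_comp continuous_const)
  convert IsResolventFunction.sum I fun e _ => isResolventFunction_timeAverage (hT e)
    (analyticOnNhd_linearFlow A (L e)) (hg e) (hgc e) (hβ e) h using 2 with z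
  have h1 := (innerSL ℝ x).intervalIntegral_comp_comm (μ := MeasureTheory.volume) (a := 0) (b := h)
    ((continuous_interactionField_left A hY z).intervalIntegrable _ _)
  rw [← innerSL_apply_apply ℝ, ← h1, ← Complex.ofReal_sum, ← intervalIntegral.integral_finsetSum]
  · simp [interactionField, T, β, map_sum]
  · exact fun e _ => ((hβ e).clm_apply
      ((hg e).comp ((hT e).clm_apply continuous_const))).intervalIntegrable _ _

/-- The flow of a linear equation perturbed by finitely many compactly supported Lipschitz fields
of linear coordinates preserves the commutative resolvent algebra at non-negative times. -/
theorem preservesResolventAlgebra_flow_of_nonneg {A : E →L[ℝ] E} {I : Finset ι}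
    {B : ι → F →L[ℝ] E} {g : ι → F → F} {L : ι → E →L[ℝ] F} (hg : ∀ e, Continuous (g e))
    (hgc : ∀ e, HasCompactSupport (g e)) {Y : E → E}
    (hYdef : Y = fun z => ∑ e ∈ I, B e (g e (L e z))) {K : ℝ≥0} (hY : LipschitzWith K Y) {M : ℝ}
    (hM : ∀ z, ‖Y z‖ ≤ M) {Φ : ℝ → E → E} (h0 : ∀ z, Φ 0 z = z)
    (hΦ : ∀ z t, HasDerivAt (fun s => Φ s z) (A (Φ t z) + Y (Φ t z)) t) {t : ℝ} (ht : 0 ≤ t) :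
    PreservesResolventAlgebra (Φ t) := by
  have hv := lipschitzWith_add_perturbation (A := A) hY
  obtain ⟨C, hC⟩ := exists_norm_linearFlow_le A t
  set κ := Real.exp ((‖A‖₊ + K : ℝ≥0) * t)
  have hκ : ∀ s ∈ Icc 0 t, ∀ z z', ‖Φ s z - Φ s z'‖ ≤ κ * ‖z - z'‖ := fun s hs z z' => by
    refine (norm_flow_sub_le hv h0 hΦ hs.1 z z').trans ?_
    gcongr
    exact Real.exp_le_exp.2 (mul_le_mul_of_nonneg_left hs.2 NNReal.zero_le_coe)
  have hcont : Continuous (Φ t) := by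
    refine (LipschitzWith.of_dist_le_mul (K := κ.toNNReal) fun z z' => ?_).continuous
    rw [dist_eq_norm, dist_eq_norm, Real.coe_toNNReal _ (Real.exp_nonneg _)]
    exact hκ t ⟨ht, le_rfl⟩ z z'
  set c := C * (C * (K * C) * (C * M))
  set h : ℕ → ℝ := fun N => t / (N + 1) with hh_def
  have hh0 : ∀ N, 0 ≤ h N := fun N => by positivity
  have hNh : ∀ N : ℕ, ((N + 1 : ℕ) : ℝ) * h N = t := fun N => by
    simp only [hh_def]
    push_cast
    field_simp
  have hht : ∀ N, h N ≤ t := fun N =>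
    div_le_self ht (by linarith [N.cast_nonneg (α := ℝ)])
  set S : ℕ → E → E := fun N z =>
    linearFlow A (h N) (z + ∫ s in (0 : ℝ)..h N, interactionField A Y s z)
  have hS : ∀ N, PreservesResolventAlgebra (S N) := fun N => by
    refine (PreservesResolventAlgebra.continuousLinearMap (linearFlow A (h N))).comp
      (.id_add ?_ fun x => ?_)
    · exact intervalIntegral.continuous_parametric_intervalIntegral_of_continuous'
        (continuous_interactionField A hY.continuous) 0 _
    · rw [hYdef]
      exact isResolventFunction_averaged_displacement A I B g L hg hgc (h N) x
  -- There are `N + 1` steps of length `t / (N + 1)`, each contributing at most `κ * c * h N ^ 2`.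
  have herr : ∀ N z, ‖Φ t z - (S N)^[N + 1] z‖ ≤ κ * c * t ^ 2 * (1 / ((N : ℝ) + 1)) := by
    intro N z
    have h1 := norm_flow_sub_iterate_le h0 (flow_add hv h0 hΦ) (hh0 N) hκ (Real.exp_nonneg _)
      (S := S N) (δ := c * h N ^ 2) (fun z => by
        simpa only [h0] using
          norm_solution_sub_averaged_step_le hY hM hC (hΦ z) (hh0 N) (hht N)) (N + 1)
      (hNh N).le z
    rw [hNh] at h1
    refine h1.trans (le_of_eq ?_)
    simp only [hh_def]
    push_cast
    field_simp
  refine .of_tendsto hcont (fun N => (hS N).iterate (N + 1)) ?_ (.of_forall herr)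
  simpa using tendsto_one_div_add_atTop_nhds_zero_nat.const_mul (κ * c * t ^ 2)

/-- For `t ≤ 0`, the reversed flow `s ↦ Φ (-s)` solves the equation with `-A` and `-Y`, and the sign
of `Y` is absorbed into `B`. -/
theorem preservesResolventAlgebra_flow {A : E →L[ℝ] E} {I : Finset ι}
    {B : ι → F →L[ℝ] E} {g : ι → F → F} {L : ι → E →L[ℝ] F} (hg : ∀ e, Continuous (g e))
    (hgc : ∀ e, HasCompactSupport (g e)) {Y : E → E}
    (hYdef : Y = fun z => ∑ e ∈ I, B e (g e (L e z))) {K : ℝ≥0} (hY : LipschitzWith K Y) {M : ℝ}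
    (hM : ∀ z, ‖Y z‖ ≤ M) {Φ : ℝ → E → E} (h0 : ∀ z, Φ 0 z = z)
    (hΦ : ∀ z t, HasDerivAt (fun s => Φ s z) (A (Φ t z) + Y (Φ t z)) t) (t : ℝ) :
    PreservesResolventAlgebra (Φ t) := by
  rcases le_total 0 t with ht | ht
  · exact preservesResolventAlgebra_flow_of_nonneg hg hgc hYdef hY hM h0 hΦ ht
  · have := preservesResolventAlgebra_flow_of_nonneg (A := -A) (B := fun e => -B e) (I := I)
      (L := L) (Y := fun z => -Y z) (Φ := fun s => Φ (-s)) hg hgc (by simp [hYdef]) hY.neg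
      (by simpa using hM) (by simpa using h0)
      (fun z s => by
        refine ((hΦ z (-s)).scomp s (hasDerivAt_neg s)).congr_deriv ?_
        simp [add_comm]) (neg_nonneg.2 ht)
    simpa using this

end Preservation

/-! ### Bounds for gradient fields and the perturbation. -/

section GradientField

variable {F : Type*} [NormedAddCommGroup F] [InnerProductSpace ℝ F] [CompleteSpace F] {V : F → ℝ}

theorem contDiff_gradient (hV : ContDiff ℝ ∞ V) : ContDiff ℝ 1 (gradient V) :=
  (InnerProductSpace.toDual ℝ F).symm.toContinuousLinearEquiv.contDiff.comp
    (hV.fderiv_right (by norm_cast))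

theorem hasCompactSupport_gradient (hV : HasCompactSupport V) : HasCompactSupport (gradient V) :=
  (hV.fderiv ℝ).comp_left (map_zero (InnerProductSpace.toDual ℝ F).symm)

theorem exists_lipschitzWith_gradient (hV : ContDiff ℝ ∞ V) (hVc : HasCompactSupport V) :
    ∃ K, LipschitzWith K (gradient V) :=
  (contDiff_gradient hV).lipschitzWith_of_hasCompactSupport (hasCompactSupport_gradient hVc)
    one_ne_zero

theorem exists_bound_gradient (hV : ContDiff ℝ ∞ V) (hVc : HasCompactSupport V) :
    ∃ M, ∀ x, ‖gradient V x‖ ≤ M :=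
  (hasCompactSupport_gradient hVc).exists_bound_of_continuous (contDiff_gradient hV).continuous

end GradientField

section Perturbation

variable {E F ι : Type*} [NormedAddCommGroup E] [NormedSpace ℝ E] [NormedAddCommGroup F]
  [NormedSpace ℝ F] (I : Finset ι) (B : ι → F →L[ℝ] E) {g : ι → F → F} (L : ι → E →L[ℝ] F)

theorem exists_lipschitzWith_perturbation (hg : ∀ e, ∃ K, LipschitzWith K (g e)) :
    ∃ K, LipschitzWith K fun z => ∑ e ∈ I, B e (g e (L e z)) := by
  classical
  induction I using Finset.induction_on with
  | empty => exact ⟨0, by simp⟩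
  | insert a s ha ih =>
    obtain ⟨K, hK⟩ := ih
    obtain ⟨K', hK'⟩ := hg a
    simp only [Finset.sum_insert ha]
    exact ⟨_, ((B a).lipschitz.comp (hK'.comp (L a).lipschitz)).add hK⟩

theorem exists_bound_perturbation (hg : ∀ e, ∃ M, ∀ y, ‖g e y‖ ≤ M) :
    ∃ M, ∀ z, ‖∑ e ∈ I, B e (g e (L e z))‖ ≤ M := by
  choose M hM using hg
  exact ⟨∑ e ∈ I, ‖B e‖ * M e, fun z => norm_sum_le_of_le _ fun e _ =>
    ((B e).le_opNorm _).trans (by gcongr; exact hM e _)⟩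

end Perturbation

/-! ### The Hamiltonian vector field as a perturbed linear field. -/

section Mechanics

variable {Γ : Type*} {Λ : Finset Γ} {n : ℕ}

/-- The map `q ↦ q_l` as a continuous linear map. -/
noncomputable def particleCLM (l : Λ) : Config Λ n →L[ℝ] EuclideanSpace ℝ (Fin n) :=
  LinearMap.toContinuousLinearMap
    { toFun := fun q => particle q l
      map_add' := fun _ _ => rfl
      map_smul' := fun _ _ => rfl }

/-- The projection of the phase space onto the positions. -/
noncomputable def posCLM : PhaseSpace Λ n →L[ℝ] Config Λ n :=
  LinearMap.toContinuousLinearMap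
    { toFun := pos
      map_add' := fun _ _ => rfl
      map_smul' := fun _ _ => rfl }

/-- The inclusion of the momenta into the phase space. -/
noncomputable def momInclusionCLM : Config Λ n →L[ℝ] PhaseSpace Λ n :=
  LinearMap.toContinuousLinearMap
    { toFun := fun p => mkPhase p 0
      map_add' := fun p p' => by
        ext (a | a) <;> simp [mkPhase]
      map_smul' := fun r p => by
        ext (a | a) <;> simp [mkPhase] }

/-- Multiplication of the coordinates of the particle `l` by `c l`. -/
noncomputable def scaleConfig (c : Λ → ℝ) (q : Config Λ n) : Config Λ n :=
  WithLp.toLp 2 fun a => c a.1 * q a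

/-- The linear vector field of the uncoupled harmonic oscillators. -/
noncomputable def oscillatorCLM (m ν : Γ → ℝ) : PhaseSpace Λ n →L[ℝ] PhaseSpace Λ n :=
  LinearMap.toContinuousLinearMap
    { toFun := fun z => mkPhase (-scaleConfig (fun l => ν l) (pos z))
        (scaleConfig (fun l => (m l)⁻¹) (mom z))
      map_add' := fun z z' => by
        ext (a | a) <;> simp [mkPhase, scaleConfig, pos, mom] <;> ring
      map_smul' := fun r z => by
        ext (a | a) <;> simp [mkPhase, scaleConfig, pos, mom] <;> ring }

/-- The relative position `q_k - q_l` of an unordered pair `{k, l}`, for a choice of its order. -/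
noncomputable def relativePositionCLM (e : Sym2 Λ) : Config Λ n →L[ℝ] EuclideanSpace ℝ (Fin n) :=
  particleCLM (Quot.out e).1 - particleCLM (Quot.out e).2

theorem pairTerm_eq (V : Γ → Γ → EuclideanSpace ℝ (Fin n) → ℝ)
    (hV : ∀ k l x, V k l x = V l k (-x)) (q : Config Λ n) (e : Sym2 Λ) :
    pairTerm V hV q e = V (Quot.out e).1 (Quot.out e).2 (relativePositionCLM e q) := by
  conv_lhs => rw [← Quot.out_eq e]
  rfl

theorem hasGradientAt_sum_norm_sq (c : Λ → ℝ) (q : Config Λ n) :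
    HasGradientAt (fun q : Config Λ n => ∑ l, c l * ‖particle q l‖ ^ 2 / 2) (scaleConfig c q) q := by
  rw [hasGradientAt_iff_hasFDerivAt]
  have h : HasFDerivAt (fun q : Config Λ n => ∑ l, c l / 2 * ‖particleCLM l q‖ ^ 2) _ q :=
    HasFDerivAt.fun_sum fun l (_ : l ∈ Finset.univ) =>
      (((particleCLM (n := n) l).hasFDerivAt (x := q)).norm_sq).const_mul (c l / 2)
  have hfun : (fun q : Config Λ n => ∑ l, c l * ‖particle q l‖ ^ 2 / 2) =
      fun q => ∑ l, c l / 2 * ‖particleCLM l q‖ ^ 2 := by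
    funext q
    refine Finset.sum_congr rfl fun l _ => ?_
    rw [show particleCLM l q = particle q l from rfl]
    ring
  rw [hfun]
  refine h.congr_fderiv ?_
  · ext1 y
    simp only [InnerProductSpace.toDual_apply_apply, PiLp.inner_apply, Fintype.sum_prod_type]
    simp only [sum_apply, smul_apply,
      ContinuousLinearMap.comp_apply, innerSL_apply_apply, smul_eq_mul]
    refine Finset.sum_congr rfl fun l _ => ?_
    rw [show particleCLM l q = particle q l from rfl, show particleCLM l y = particle y l from rfl]
    simp only [PiLp.inner_apply, particle, scaleConfig, nsmul_eq_mul, Finset.mul_sum]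
    refine Finset.sum_congr rfl fun i _ => ?_
    simp
    ring

theorem hasGradientAt_hamiltonian_pos (m ν : Γ → ℝ)
    {V : Γ → Γ → EuclideanSpace ℝ (Fin n) → ℝ} (hV : ∀ k l x, V k l x = V l k (-x))
    (hVsmooth : ∀ k l, ContDiff ℝ ∞ (V k l)) (N : Finset (Sym2 Λ)) (p q : Config Λ n) :
    HasGradientAt (fun q => hamiltonian Λ n m ν V hV N (mkPhase p q))
      (scaleConfig (fun l => ν l) q + ∑ e ∈ N, (relativePositionCLM e).adjoint
        (gradient (V (Quot.out e).1 (Quot.out e).2) (relativePositionCLM e q))) q := by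
  have h1 := (hasGradientAt_sum_norm_sq (fun l : Λ => ν l) q).hasFDerivAt
  have h2 : HasFDerivAt (fun q : Config Λ n =>
      ∑ e ∈ N, V (Quot.out e).1 (Quot.out e).2 (relativePositionCLM e q)) _ q :=
    HasFDerivAt.fun_sum fun e (_ : e ∈ N) =>
      (((hVsmooth (Quot.out e).1 (Quot.out e).2).differentiable (by simp)
        (relativePositionCLM e q)).hasGradientAt.hasFDerivAt).comp q
        (relativePositionCLM e).hasFDerivAt
  rw [hasGradientAt_iff_hasFDerivAt]
  have hfun : (fun q : Config Λ n => hamiltonian Λ n m ν V hV N (mkPhase p q)) = fun q =>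
      ∑ l : Λ, ‖particle p l‖ ^ 2 / (2 * m l) + (∑ l : Λ, ν l * ‖particle q l‖ ^ 2 / 2 +
        ∑ e ∈ N, V (Quot.out e).1 (Quot.out e).2 (relativePositionCLM e q)) := by
    funext q
    simp only [hamiltonian, freeHamiltonian, pairTerm_eq, Finset.sum_add_distrib]
    rw [add_assoc]
    rfl
  rw [hfun]
  refine ((h1.add h2).const_add _).congr_fderiv ?_
  · rw [map_add, map_sum]
    congr 1
    refine Finset.sum_congr rfl fun e _ => ?_
    ext1 y
    simp [ContinuousLinearMap.adjoint_inner_left]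

theorem hasGradientAt_hamiltonian_mom (m ν : Γ → ℝ)
    {V : Γ → Γ → EuclideanSpace ℝ (Fin n) → ℝ} (hV : ∀ k l x, V k l x = V l k (-x))
    (N : Finset (Sym2 Λ)) (p q : Config Λ n) :
    HasGradientAt (fun p => hamiltonian Λ n m ν V hV N (mkPhase p q))
      (scaleConfig (fun l => (m l)⁻¹) p) p := by
  have h1 := (hasGradientAt_sum_norm_sq (fun l : Λ => (m l)⁻¹) p).hasFDerivAt
  rw [hasGradientAt_iff_hasFDerivAt]
  have hfun : (fun p : Config Λ n => hamiltonian Λ n m ν V hV N (mkPhase p q)) = fun p =>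
      ∑ l : Λ, (m l)⁻¹ * ‖particle p l‖ ^ 2 / 2 +
        (∑ l : Λ, ν l * ‖particle q l‖ ^ 2 / 2 + ∑ e ∈ N, pairTerm V hV q e) := by
    funext p
    simp only [hamiltonian, freeHamiltonian, Finset.sum_add_distrib]
    rw [add_assoc]
    refine congrArg₂ _ (Finset.sum_congr rfl fun l _ => ?_) rfl
    rw [show particle (mom (mkPhase p q)) l = particle p l from rfl, div_eq_mul_inv, mul_inv]
    ring
  rw [hfun]
  exact h1.add_const _

/-- By the chain rule, each pair force is a gradient evaluated at the relative position and carried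
back by the adjoint; it acts on the momenta only. -/
theorem hamiltonianVectorField_hamiltonian (m ν : Γ → ℝ)
    {V : Γ → Γ → EuclideanSpace ℝ (Fin n) → ℝ} (hV : ∀ k l x, V k l x = V l k (-x))
    (hVsmooth : ∀ k l, ContDiff ℝ ∞ (V k l)) (N : Finset (Sym2 Λ)) (z : PhaseSpace Λ n) :
    hamiltonianVectorField (hamiltonian Λ n m ν V hV N) z =
      oscillatorCLM m ν z + ∑ e ∈ N, (-momInclusionCLM.comp (relativePositionCLM e).adjoint)
        (gradient (V (Quot.out e).1 (Quot.out e).2)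
          (((relativePositionCLM e).comp posCLM) z)) := by
  rw [hamiltonianVectorField, (hasGradientAt_hamiltonian_pos m ν hV hVsmooth N _ _).gradient,
    (hasGradientAt_hamiltonian_mom m ν hV N _ _).gradient]
  simp only [neg_apply, ContinuousLinearMap.comp_apply, Finset.sum_neg_distrib,
    ← map_sum]
  set S := ∑ e ∈ N, (relativePositionCLM e).adjoint
    (gradient (V (Quot.out e).1 (Quot.out e).2) (relativePositionCLM e (posCLM z)))
  change mkPhase (-(scaleConfig (fun l => ν l) (pos z) + S)) _ =
    mkPhase (-scaleConfig (fun l => ν l) (pos z)) _ + -mkPhase S 0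
  ext (a | a)
  · simp [mkPhase]
    ring
  · simp [mkPhase]

end Mechanics

end CommResolvent

theorem mainTheorem3 {Γ : Type*} (n : ℕ) (Λ : Finset Γ) (m ν : Γ → ℝ)
    (hm : ∀ k, 0 < m k) (hν : ∀ k, 0 < ν k)
    (V : Γ → Γ → EuclideanSpace ℝ (Fin n) → ℝ)
    (hVsymm : ∀ k l x, V k l x = V l k (-x))
    (hVsmooth : ∀ k l, ContDiff ℝ ∞ (V k l))
    (hVsupp : ∀ k l, HasCompactSupport (V k l))
    (N : Finset (Sym2 Λ)) (hN : ∀ e ∈ N, ¬ e.IsDiag) :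
    (∃! Φ : ℝ → CommResolvent.PhaseSpace Λ n → CommResolvent.PhaseSpace Λ n,
      CommResolvent.IsHamiltonianFlow
        (CommResolvent.hamiltonian Λ n m ν V hVsymm N) Φ) ∧
    ∀ Φ : ℝ → CommResolvent.PhaseSpace Λ n → CommResolvent.PhaseSpace Λ n,
      CommResolvent.IsHamiltonianFlow
        (CommResolvent.hamiltonian Λ n m ν V hVsymm N) Φ →
      ∀ t : ℝ, ∃ hc : Continuous (Φ t),
        (fun f : BoundedContinuousFunction (CommResolvent.PhaseSpace Λ n) ℂ =>
            f.compContinuous ⟨Φ t, hc⟩) ''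
          (CommResolvent.resolventAlgebra (CommResolvent.PhaseSpace Λ n) :
            Set (BoundedContinuousFunction (CommResolvent.PhaseSpace Λ n) ℂ)) =
        (CommResolvent.resolventAlgebra (CommResolvent.PhaseSpace Λ n) :
          Set (BoundedContinuousFunction (CommResolvent.PhaseSpace Λ n) ℂ)) := by
  open CommResolvent in
  let A : PhaseSpace Λ n →L[ℝ] PhaseSpace Λ n := oscillatorCLM m ν
  let B : Sym2 Λ → EuclideanSpace ℝ (Fin n) →L[ℝ] PhaseSpace Λ n := fun e =>
    -momInclusionCLM.comp (relativePositionCLM e).adjoint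
  let L : Sym2 Λ → PhaseSpace Λ n →L[ℝ] EuclideanSpace ℝ (Fin n) := fun e =>
    (relativePositionCLM e).comp posCLM
  let g : Sym2 Λ → EuclideanSpace ℝ (Fin n) → EuclideanSpace ℝ (Fin n) := fun e =>
    gradient (V (Quot.out e).1 (Quot.out e).2)
  let Y : PhaseSpace Λ n → PhaseSpace Λ n := fun z => ∑ e ∈ N, B e (g e (L e z))
  have hfield : ∀ z, hamiltonianVectorField (hamiltonian Λ n m ν V hVsymm N) z = A z + Y z :=
    hamiltonianVectorField_hamiltonian m ν hVsymm hVsmooth N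
  obtain ⟨K, hY⟩ : ∃ K, LipschitzWith K Y := exists_lipschitzWith_perturbation N B L fun e =>
    exists_lipschitzWith_gradient (hVsmooth _ _) (hVsupp _ _)
  obtain ⟨M, hM⟩ : ∃ M, ∀ z, ‖Y z‖ ≤ M := exists_bound_perturbation N B L fun e =>
    exists_bound_gradient (hVsmooth _ _) (hVsupp _ _)
  have hv : LipschitzWith (‖A‖₊ + K) fun z => A z + Y z := lipschitzWith_add_perturbation hY
  have hflow : ∀ Φ : ℝ → PhaseSpace Λ n → PhaseSpace Λ n,
      IsHamiltonianFlow (hamiltonian Λ n m ν V hVsymm N) Φ ↔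
        ∀ z, Φ 0 z = z ∧ ∀ t, HasDerivAt (fun s => Φ s z) (A (Φ t z) + Y (Φ t z)) t := fun Φ => by
    simp only [IsHamiltonianFlow, hfield]
  constructor
  · choose γ hγ0 hγ using exists_global_solution (A := A) hY hM
    refine ⟨fun t z => γ z t, (hflow _).2 fun z => ⟨hγ0 z, hγ z⟩, fun Φ hΦ => ?_⟩
    replace hΦ := (hflow Φ).1 hΦ
    funext t z
    exact congrFun (ODE_solution_unique_univ (v := fun _ z => A z + Y z) (s := fun _ => Set.univ)
      (t₀ := 0) (fun _ => hv.lipschitzOnWith) (fun t => ⟨(hΦ z).2 t, trivial⟩)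
      (fun t => ⟨hγ z t, trivial⟩) ((hΦ z).1.trans (hγ0 z).symm)) t
  · intro Φ hΦ t
    rw [hflow] at hΦ
    have hpres : ∀ t, PreservesResolventAlgebra (Φ t) :=
      preservesResolventAlgebra_flow (I := N) (B := B) (g := g) (L := L)
        (fun e => (contDiff_gradient (hVsmooth _ _)).continuous)
        (fun e => hasCompactSupport_gradient (hVsupp _ _)) rfl hY hM (fun z => (hΦ z).1)
        fun z => (hΦ z).2
    exact ⟨(hpres t).1, image_resolventAlgebra_eq (fun z => (hΦ z).1)
      (flow_add hv (fun z => (hΦ z).1) fun z => (hΦ z).2) hpres t⟩
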